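/- Let $\mathcal{A}$ be a commutative $\mathbb{C}$-algebra, let $\mathcal{C}=\mathcal{A}[[t_1,t_2,\dotsc]]$, and let $\mathcal{R}=\mathcal{C}[[x]]$ or $\mathcal{R}=\mathcal{C}((x))$. Write $\partial=\partial/\partial x$. A microdifferential operator is a formal series $P=\sum_{k\in\mathbb{Z}}a_k\partial^k$ with $a_k\in\mathcal{R}$ and $a_k=0$ for $k\gg0$; such operators are multiplied by the extended Leibniz rule $$\Bigl(\sum_k a_k\partial^k\Bigr)\Bigl(\sum_k b_k\partial^k\Bigr)=\sum_{k\in\mathbb{Z}}\Bigl(\sum_{l+m-r=k,\ r\ge0}\binom{l}{r}a_l\,(\partial^r b_m)\Bigr)\partial^k .$$ Put $[P,Q]=PQ-QP$ and $\frac{\partial P}{\partial t_n}=\sum_k\frac{\partial a_k}{\partial t_n}\partial^k$. The operator $P$ is a differential operator if $a_k=0$ for all $k<0$, and it is monic of order $n$ if $a_n=1$ and $a_k=0$ for all $k>n$. Let $(B_n)_{n\ge1}$ be a sequence of differential operators over $\mathcal{R}$, with $B_n=\partial^n+b_{n,n-1}\partial^{n-1}+\dotsb+b_{n,0}$ monic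 of order $n$, which satisfies the Zakharov–Shabat equations $$\frac{\partial B_n}{\partial t_m}-\frac{\partial B_m}{\partial t_n}+[B_n,B_m]=0\qquad(n,m=1,2,\dotsc).$$ Then there exists a monic first-order microdifferential operator $L=\partial+u_0+u_{-1}\partial^{-1}+u_{-2}\partial^{-2}+\dotsb$ with $u_i\in\mathcal{R}$ such that $$\frac{\partial L}{\partial t_n}=[B_n,L]\qquad(n=1,2,\dotsc).$$ Moreover, if $b_{n,n-1}=0$ for all $n\ge1$, then $L$ can be chosen with $u_0=0$, that is, $L=\partial+u_{-1}\partial^{-1}+u_{-2}\partial^{-2}+\dotsb$. -/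

import Mathlib

noncomputable section

universe u

/-- Microdifferential operators `∑_{k ∈ ℤ} a_k ∂^k` (`a_k ∈ R`, `a_k = 0` for `k ≫ 0`) over a
commutative ring `R`, where `∂` acts on `R` by `D`. The map `D` is a phantom parameter of the
type; it enters through the product. -/
@[ext]
structure MicroDiffOp {R : Type u} [CommRing R] (D : R →+ R) where
  /-- The coefficient `a_k` of `∂^k`. -/
  coeff : ℤ → R
  eventually_zero : ∃ N : ℤ, ∀ k : ℤ, N < k → coeff k = 0

namespace MicroDiffOp

variable {R : Type u} [CommRing R] {D : R →+ R}

instance : Zero (MicroDiffOp D) := ⟨⟨fun _ => 0, 0, fun _ _ => rfl⟩⟩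

instance : Add (MicroDiffOp D) :=
  ⟨fun P Q => ⟨fun k => P.coeff k + Q.coeff k, by
    obtain ⟨N, hN⟩ := P.eventually_zero
    obtain ⟨M, hM⟩ := Q.eventually_zero
    refine ⟨max N M, fun k hk => ?_⟩
    rw [hN k (lt_of_le_of_lt (le_max_left _ _) hk), hM k (lt_of_le_of_lt (le_max_right _ _) hk),
      add_zero]⟩⟩

instance : Sub (MicroDiffOp D) :=
  ⟨fun P Q => ⟨fun k => P.coeff k - Q.coeff k, by
    obtain ⟨N, hN⟩ := P.eventually_zero
    obtain ⟨M, hM⟩ := Q.eventually_zero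
    refine ⟨max N M, fun k hk => ?_⟩
    rw [hN k (lt_of_le_of_lt (le_max_left _ _) hk), hM k (lt_of_le_of_lt (le_max_right _ _) hk),
      sub_zero]⟩⟩

/-- The summand `binom(l, r) a_l b_m^{(r)}` of the coefficient of `∂^k` in the product `P Q`, where
`p = (l, r)` and `m = k + r - l`. -/
def mulTerm (P Q : MicroDiffOp D) (k : ℤ) (p : ℤ × ℕ) : R :=
  Ring.choose p.1 p.2 • (P.coeff p.1 * D^[p.2] (Q.coeff (k + p.2 - p.1)))

theorem iterate_map_zero' (D : R →+ R) (r : ℕ) : D^[r] 0 = 0 := by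
  induction r with
  | zero => rfl
  | succ r ih => rw [Function.iterate_succ_apply', ih, map_zero]

theorem mulTerm_eq_zero {P Q : MicroDiffOp D} {N M : ℤ} (hN : ∀ k, N < k → P.coeff k = 0)
    (hM : ∀ k, M < k → Q.coeff k = 0) (k : ℤ) (p : ℤ × ℕ)
    (h : N < p.1 ∨ M < k + p.2 - p.1) : mulTerm P Q k p = 0 := by
  unfold mulTerm
  rcases h with h | h
  · rw [hN _ h, zero_mul, smul_zero]
  · rw [hM _ h, iterate_map_zero', mul_zero, smul_zero]

/-- Only finitely many summands of each coefficient of a product are nonzero, so the `finsum` in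
the definition of the product is a genuine finite sum. -/
theorem finite_support_mulTerm (P Q : MicroDiffOp D) (k : ℤ) :
    (Function.support (mulTerm P Q k)).Finite := by
  obtain ⟨N, hN⟩ := P.eventually_zero
  obtain ⟨M, hM⟩ := Q.eventually_zero
  refine ((Set.finite_Icc (k - M) N).prod (Set.finite_Iic (N + M - k).toNat)).subset ?_
  intro p hp
  have h : ¬ (N < p.1 ∨ M < k + p.2 - p.1) := fun h => hp (mulTerm_eq_zero hN hM k p h)
  simp only [Set.mem_prod, Set.mem_Icc, Set.mem_Iic]
  omega

/-- The product, by the extended Leibniz rule: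
`P Q = ∑_k (∑_{l + m - r = k, r ≥ 0} binom(l, r) a_l b_m^{(r)}) ∂^k`. -/
instance : Mul (MicroDiffOp D) :=
  ⟨fun P Q => ⟨fun k => ∑ᶠ p : ℤ × ℕ, mulTerm P Q k p, by
    obtain ⟨N, hN⟩ := P.eventually_zero
    obtain ⟨M, hM⟩ := Q.eventually_zero
    refine ⟨N + M, fun k hk => finsum_eq_zero_of_forall_eq_zero fun p => ?_⟩
    exact mulTerm_eq_zero hN hM k p (by omega)⟩⟩

/-- The commutator `[P, Q] = P Q - Q P`. -/
def commutator (P Q : MicroDiffOp D) : MicroDiffOp D := P * Q - Q * P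

/-- Coefficientwise application of an additive map `δ`. For `δ = ∂/∂t_n` on `R` this is
the operator `∂P/∂t_n`. -/
def mapCoeff (δ : R →+ R) (P : MicroDiffOp D) : MicroDiffOp D :=
  ⟨fun k => δ (P.coeff k), by
    obtain ⟨N, hN⟩ := P.eventually_zero
    exact ⟨N, fun k hk => by rw [hN k hk, map_zero]⟩⟩

/-- `P` is a differential operator: no negative powers of `∂` occur. -/
def IsDifferential (P : MicroDiffOp D) : Prop := ∀ k : ℤ, k < 0 → P.coeff k = 0

/-- `P = ∂^n + (terms of order < n)`. -/
def IsMonicOfOrder (P : MicroDiffOp D) (n : ℤ) : Prop :=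
  P.coeff n = 1 ∧ ∀ k : ℤ, n < k → P.coeff k = 0

/-- The Zakharov–Shabat equations
`∂B_n/∂t_m - ∂B_m/∂t_n + [B_n, B_m] = 0` for all `n, m ≥ 1`; here `δ n` is `∂/∂t_n` on `R`. -/
def ZakharovShabat (δ : ℕ+ → R →+ R) (B : ℕ+ → MicroDiffOp D) : Prop :=
  ∀ n m : ℕ+, mapCoeff (δ m) (B n) - mapCoeff (δ n) (B m) + commutator (B n) (B m) = 0

/-- The Lax equations `∂L/∂t_n = [B_n, L]` for all `n ≥ 1`. -/
def LaxEquations (δ : ℕ+ → R →+ R) (B : ℕ+ → MicroDiffOp D) (L : MicroDiffOp D) : Prop :=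
  ∀ n : ℕ+, mapCoeff (δ n) L = commutator (B n) L

end MicroDiffOp

/-- The ring `𝒞 = A[[t]]`, `t = (t_1, t_2, …)`. -/
abbrev TimeSeries (A : Type u) : Type u := MvPowerSeries ℕ+ A

/-- `∂ = d/dx` on `𝒞[[x]]`. -/
def powerSeriesDx (A : Type u) [CommRing A] :
    PowerSeries (TimeSeries A) →+ PowerSeries (TimeSeries A) :=
  (PowerSeries.derivative (TimeSeries A)).toLinearMap.toAddMonoidHom

/-- `∂/∂t_n` on `𝒞[[x]]`, acting on the coefficients of the powers of `x`. -/
def powerSeriesDt (A : Type u) [CommRing A] (n : ℕ+) :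
    PowerSeries (TimeSeries A) →+ PowerSeries (TimeSeries A) where
  toFun f := PowerSeries.mk fun k => MvPowerSeries.pderiv A n (PowerSeries.coeff k f)
  map_zero' := by ext1 k; simp
  map_add' f g := by ext1 k; simp

/-- `∂ = d/dx` on `𝒞((x))`. -/
def laurentSeriesDx (A : Type u) [CommRing A] :
    LaurentSeries (TimeSeries A) →+ LaurentSeries (TimeSeries A) :=
  (LaurentSeries.derivative (TimeSeries A)).toAddMonoidHom

/-- `∂/∂t_n` on `𝒞((x))`, acting on the coefficients of the powers of `x`. -/
def laurentSeriesDt (A : Type u) [CommRing A] (n : ℕ+) :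
    LaurentSeries (TimeSeries A) →+ LaurentSeries (TimeSeries A) where
  toFun f := HahnSeries.map f (MvPowerSeries.pderiv A n)
  map_zero' := by ext1; funext k; simp
  map_add' f g := by ext1; funext k; simp

end

/-!
The quotients `B_{n+j} B_n⁻¹`, `n → ∞`, solve the Lax equations approximately: they are monic of
order `j`, and the orders of their covariant derivatives `∂/∂t_m - [B_m, ·]` tend to `-∞`, since
`∂B_n/∂t_m - [B_m, B_n] = ∂B_m/∂t_n` has order less than `m` for every `n`. Taken over all `j` they
form a frame, in which any operator can be expanded from the top. If the covariant derivatives of an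
operator along two consecutive times have low enough order, this expansion shows that its leading
coefficient is independent of `x` and of the first of these times.

Hence the leading coefficient of the difference of successive quotients `B_{n+1} B_n⁻¹` is
asymptotically constant. As formal power series in infinitely many times are complete modulo such
constants, that coefficient becomes stationary once an asymptotically constant multiple of the frame
is added to each quotient. Repeating this one order at a time makes the sequence converge, and the
limit is `L`.
-/

/-- The Leibniz rule for a map bundled only as additive, the form in which derivations enter the
type `MicroDiffOp D`. -/
class IsDerivation {R : Type*} [CommRing R] (D : R →+ R) : Prop where
  map_mul (a b : R) : D (a * b) = a * D b + D a * b

namespace IsDerivation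

variable {R : Type*} [CommRing R] (D : R →+ R) [IsDerivation D]

theorem map_one : D 1 = 0 := by
  simpa using map_mul (D := D) 1 1

variable {D}

theorem map_const_mul {c : R} (hc : D c = 0) (a : R) : D (c * a) = c * D a := by
  rw [map_mul, hc, zero_mul, add_zero]

theorem iterate_const_mul {c : R} (hc : D c = 0) (r : ℕ) (a : R) :
    D^[r] (c * a) = c * D^[r] a :=
  Function.Commute.iterate_left (f := D) (g := (c * ·)) (map_const_mul hc) r a

end IsDerivation

open Filter

noncomputable section

namespace MicroDiffOp

variable {R : Type*} [CommRing R] {D : R →+ R}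

instance : Neg (MicroDiffOp D) :=
  ⟨fun P => ⟨fun k => -P.coeff k,
    P.eventually_zero.imp fun N hN k hk => by rw [hN k hk, neg_zero]⟩⟩

instance {S : Type*} [SMulZeroClass S R] : SMul S (MicroDiffOp D) :=
  ⟨fun c P => ⟨fun k => c • P.coeff k,
    P.eventually_zero.imp fun N hN k hk => by rw [hN k hk, smul_zero]⟩⟩

theorem coeff_injective : Function.Injective (coeff : MicroDiffOp D → ℤ → R) :=
  fun _ _ h => MicroDiffOp.ext h

instance : AddCommGroup (MicroDiffOp D) :=
  coeff_injective.addCommGroup coeff rfl (fun _ _ => rfl) (fun _ => rfl) (fun _ _ => rfl)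
    (fun _ _ => rfl) (fun _ _ => rfl)

instance : Module R (MicroDiffOp D) :=
  coeff_injective.module R { toFun := coeff, map_zero' := rfl, map_add' := fun _ _ => rfl }
    fun _ _ => rfl

@[simp] theorem coeff_zero (k : ℤ) : (0 : MicroDiffOp D).coeff k = 0 := rfl

@[simp] theorem coeff_add (P Q : MicroDiffOp D) (k : ℤ) :
    (P + Q).coeff k = P.coeff k + Q.coeff k := rfl

@[simp] theorem coeff_sub (P Q : MicroDiffOp D) (k : ℤ) :
    (P - Q).coeff k = P.coeff k - Q.coeff k := rfl

@[simp] theorem coeff_smul (c : R) (P : MicroDiffOp D) (k : ℤ) :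
    (c • P).coeff k = c * P.coeff k := rfl

@[simp] theorem coeff_mapCoeff (δ : R →+ R) (P : MicroDiffOp D) (k : ℤ) :
    (mapCoeff δ P).coeff k = δ (P.coeff k) := rfl

variable (D) in
/-- The operator `∂ ^ l`, for `l` of any sign. -/
def delPow (l : ℤ) : MicroDiffOp D :=
  ⟨fun k => if k = l then 1 else 0, l, fun _ hk => if_neg hk.ne'⟩

theorem coeff_delPow (l k : ℤ) : (delPow D l).coeff k = if k = l then 1 else 0 := rfl

variable (D) in
/-- The submodule of operators of order at most `N`. -/
def orderLE (N : ℤ) : Submodule R (MicroDiffOp D) where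
  carrier := {P | ∀ k, N < k → P.coeff k = 0}
  zero_mem' _ _ := rfl
  add_mem' hP hQ k hk := by rw [coeff_add, hP k hk, hQ k hk, add_zero]
  smul_mem' c P hP k hk := by rw [coeff_smul, hP k hk, mul_zero]

variable {P Q : MicroDiffOp D} {N M : ℤ}

theorem mem_orderLE : P ∈ orderLE D N ↔ ∀ k, N < k → P.coeff k = 0 := Iff.rfl

variable (P) in
theorem exists_mem_orderLE : ∃ N, P ∈ orderLE D N := P.eventually_zero

theorem orderLE_mono : Monotone (orderLE D) :=
  fun _ _ hNM _ hP k hk => hP k (hNM.trans_lt hk)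

theorem delPow_mem_orderLE (l : ℤ) : delPow D l ∈ orderLE D l :=
  fun _ hk => if_neg hk.ne'

theorem mapCoeff_mem_orderLE (δ : R →+ R) (hP : P ∈ orderLE D N) :
    mapCoeff δ P ∈ orderLE D N := fun k hk => by
  rw [coeff_mapCoeff, hP k hk, map_zero]

theorem mul_mem_orderLE (hP : P ∈ orderLE D N) (hQ : Q ∈ orderLE D M) :
    P * Q ∈ orderLE D (N + M) := fun k hk =>
  finsum_eq_zero_of_forall_eq_zero fun p => mulTerm_eq_zero hP hQ k p (by lia)

theorem mem_orderLE_sub_one (hP : P ∈ orderLE D N) (hN : P.coeff N = 0) :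
    P ∈ orderLE D (N - 1) := fun k hk => by
  rcases eq_or_lt_of_le (show N ≤ k by lia) with rfl | hlt
  · exact hN
  · exact hP k hlt

theorem mem_orderLE_of_forall_coeff_eq_zero
    (h : ∀ M, N < M → P ∈ orderLE D M → P.coeff M = 0) : P ∈ orderLE D N := by
  have descend (d : ℕ) : P ∈ orderLE D (N + d) → P ∈ orderLE D N := by
    induction d with
    | zero => simp
    | succ d ih =>
      intro hP
      have hP' := mem_orderLE_sub_one hP (h _ (by lia) hP)
      exact ih (by convert hP' using 2; push_cast; ring)
  obtain ⟨M, hM⟩ := P.exists_mem_orderLE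
  exact descend (M - N).toNat (orderLE_mono (by lia) hM)

theorem eq_zero_of_forall_mem_orderLE (h : ∀ k : ℕ, P ∈ orderLE D (N - k)) : P = 0 :=
  MicroDiffOp.ext <| funext fun j => h (N - j + 1).toNat j (by lia)

theorem sub_smul_delPow_mem_orderLE (hP : P ∈ orderLE D N) :
    P - P.coeff N • delPow D N ∈ orderLE D (N - 1) :=
  mem_orderLE_sub_one (sub_mem hP (Submodule.smul_mem _ _ (delPow_mem_orderLE N)))
    (by simp [coeff_delPow])

/-! ### The product -/

theorem coeff_mul (P Q : MicroDiffOp D) (k : ℤ) : (P * Q).coeff k = ∑ᶠ p, mulTerm P Q k p := rfl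

theorem coeff_mul_eq_sum {k : ℤ} {s : Finset (ℤ × ℕ)} (hs : ∀ p ∉ s, mulTerm P Q k p = 0) :
    (P * Q).coeff k = ∑ p ∈ s, mulTerm P Q k p :=
  finsum_eq_sum_of_support_subset _ fun p => not_imp_comm.mp (hs p)

instance : NonUnitalNonAssocRing (MicroDiffOp D) where
  left_distrib P Q S := by
    ext k
    rw [coeff_add, coeff_mul, coeff_mul, coeff_mul,
      ← finsum_add_distrib (finite_support_mulTerm _ _ _) (finite_support_mulTerm _ _ _)]
    exact finsum_congr fun p => by
      simp only [mulTerm, coeff_add, iterate_map_add, mul_add, smul_add]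
  right_distrib P Q S := by
    ext k
    rw [coeff_add, coeff_mul, coeff_mul, coeff_mul,
      ← finsum_add_distrib (finite_support_mulTerm _ _ _) (finite_support_mulTerm _ _ _)]
    exact finsum_congr fun p => by simp only [mulTerm, coeff_add, add_mul, smul_add]
  zero_mul P := by
    ext k
    exact finsum_eq_zero_of_forall_eq_zero fun p => by simp [mulTerm]
  mul_zero P := by
    ext k
    exact finsum_eq_zero_of_forall_eq_zero fun p => by simp [mulTerm]

instance : IsScalarTower R (MicroDiffOp D) (MicroDiffOp D) where
  smul_assoc c P Q := by
    ext k
    simp only [smul_eq_mul, coeff_smul, coeff_mul]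
    rw [mul_finsum' _ _ (finite_support_mulTerm _ _ _)]
    exact finsum_congr fun p => by simp only [mulTerm, coeff_smul, mul_smul_comm, mul_assoc]

theorem coeff_mul_add (hP : P ∈ orderLE D N) (hQ : Q ∈ orderLE D M) :
    (P * Q).coeff (N + M) = P.coeff N * Q.coeff M := by
  rw [coeff_mul_eq_sum (s := {(N, 0)})]
  · simp [mulTerm]
  · rintro ⟨l, r⟩ h
    simp only [Finset.mem_singleton, Prod.mk.injEq, not_and] at h
    exact mulTerm_eq_zero hP hQ _ _ (by simp only; lia)

theorem coeff_mul_add_sub_one (hP : P ∈ orderLE D N) (hQ : Q ∈ orderLE D M) :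
    (P * Q).coeff (N + M - 1) =
      P.coeff N * Q.coeff (M - 1) + P.coeff (N - 1) * Q.coeff M +
        N * (P.coeff N * D (Q.coeff M)) := by
  rw [coeff_mul_eq_sum (s := {(N, 0), (N - 1, 0), (N, 1)})]
  · rw [Finset.sum_insert (by grind), Finset.sum_insert (by simp), Finset.sum_singleton,
      add_assoc]
    have index_eq : N + M - 1 - N = M - 1 := by ring
    simp [mulTerm, index_eq]
  · rintro ⟨l, r⟩ h
    simp only [Finset.mem_singleton, Finset.mem_insert, Prod.mk.injEq, not_or, not_and] at h
    exact mulTerm_eq_zero hP hQ _ _ (by simp only; lia)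

theorem coeff_delPow_mul {l k : ℤ} {T : ℕ} (hQ : Q ∈ orderLE D M) (hT : l + M - k < T) :
    (delPow D l * Q).coeff k =
      ∑ r ∈ Finset.range T, Ring.choose l r • D^[r] (Q.coeff (k + r - l)) := by
  rw [coeff_mul_eq_sum (s := {l} ×ˢ Finset.range T)]
  · simp [mulTerm, coeff_delPow]
  · intro p hp
    by_cases hl : p.1 = l
    · refine mulTerm_eq_zero (delPow_mem_orderLE l) hQ k p (Or.inr ?_)
      simp only [Finset.mem_product, Finset.mem_singleton, Finset.mem_range, hl, true_and] at hp
      lia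
    · simp [mulTerm, coeff_delPow, hl]

theorem delPow_zero_mul (Q : MicroDiffOp D) : delPow D 0 * Q = Q := by
  ext k
  obtain ⟨M, hQ⟩ := Q.exists_mem_orderLE
  rw [coeff_delPow_mul (T := (M - k).toNat + 1) hQ (by lia), Finset.sum_range_succ']
  simp

theorem coeff_del_mul (Q : MicroDiffOp D) (k : ℤ) :
    (delPow D 1 * Q).coeff k = Q.coeff (k - 1) + D (Q.coeff k) := by
  obtain ⟨M, hQ⟩ := Q.exists_mem_orderLE
  rw [coeff_delPow_mul (T := (M + 1 - k).toNat + 2) hQ (by lia), Finset.sum_range_succ',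
    Finset.sum_range_succ', Finset.sum_eq_zero, zero_add, add_comm]
  · simp
  · intro r _
    rw [← Nat.cast_one, Ring.choose_natCast, Nat.choose_eq_zero_of_lt (by lia)]
    simp

theorem del_mul_delPow_mul (l : ℤ) (Q : MicroDiffOp D) :
    delPow D 1 * (delPow D l * Q) = delPow D (l + 1) * Q := by
  ext k
  obtain ⟨M, hQ⟩ := Q.exists_mem_orderLE
  obtain ⟨T, hT⟩ : ∃ T : ℕ, l + M - k < T := ⟨(l + M - k + 1).toNat, by lia⟩
  rw [coeff_del_mul, coeff_delPow_mul (T := T + 1) hQ (by push_cast; lia), coeff_delPow_mul hQ hT,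
    coeff_delPow_mul (T := T + 1) hQ (by push_cast; lia), Finset.sum_range_succ',
    Finset.sum_range_succ' _ T, map_sum, add_right_comm, ← Finset.sum_add_distrib]
  congr 1
  · refine Finset.sum_congr rfl fun r _ => ?_
    rw [Ring.choose_succ_succ, add_smul, map_zsmul, ← Function.iterate_succ_apply' D, add_comm]
    have index_left : k - 1 + (r + 1 : ℕ) - l = k + r - l := by push_cast; ring
    have index_right : k + (r + 1 : ℕ) - (l + 1) = k + r - l := by push_cast; ring
    rw [index_left, index_right]
  · have index_eq : k - 1 + (0 : ℕ) - l = k + (0 : ℕ) - (l + 1) := by push_cast; ring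
    rw [index_eq, Ring.choose_zero_right, Ring.choose_zero_right]

theorem eq_zero_of_del_mul_eq_zero (h : delPow D 1 * Q = 0) : Q = 0 := by
  have coeff_eq_zero (M : ℤ) (hQ : Q ∈ orderLE D M) : Q.coeff M = 0 := by
    simpa [coeff_del_mul, hQ (M + 1) (lt_add_one M)] using congrArg (coeff · (M + 1)) h
  exact eq_zero_of_forall_mem_orderLE (N := 0) fun k =>
    mem_orderLE_of_forall_coeff_eq_zero fun M _ => coeff_eq_zero M

theorem addMonoidHom_eq_zero {f : MicroDiffOp D →+ MicroDiffOp D} {d : ℤ}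
    (hf : ∀ N, ∀ P ∈ orderLE D N, f P ∈ orderLE D (N + d))
    (h_monomial : ∀ (a : R) (l : ℤ), f (a • delPow D l) = 0) : f = 0 := by
  ext1 P
  obtain ⟨N, hP⟩ := P.exists_mem_orderLE
  have truncate (k : ℕ) : ∃ Q ∈ orderLE D (N - k), f Q = f P := by
    induction k with
    | zero => exact ⟨P, by simpa using hP, rfl⟩
    | succ k ih =>
      obtain ⟨Q, hQ, hfQ⟩ := ih
      refine ⟨Q - Q.coeff (N - k) • delPow D (N - k), ?_, ?_⟩
      · simpa [sub_sub] using sub_smul_delPow_mem_orderLE hQ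
      · rw [map_sub, h_monomial, sub_zero, hfQ]
  refine eq_zero_of_forall_mem_orderLE (N := N + d) fun k => ?_
  obtain ⟨Q, hQ, hfQ⟩ := truncate k
  rw [← hfQ]
  convert hf _ Q hQ using 2
  ring

theorem mul_assoc_of_forall_smul_delPow {P S : MicroDiffOp D}
    (h : ∀ (a : R) (l : ℤ), P * (a • delPow D l * S) = P * (a • delPow D l) * S)
    (Q : MicroDiffOp D) : P * (Q * S) = P * Q * S := by
  obtain ⟨p, hP⟩ := P.exists_mem_orderLE
  obtain ⟨s, hS⟩ := S.exists_mem_orderLE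
  let associator : MicroDiffOp D →+ MicroDiffOp D :=
    (AddMonoidHom.mulLeft P).comp (AddMonoidHom.mulRight S) -
      (AddMonoidHom.mulRight S).comp (AddMonoidHom.mulLeft P)
  suffices associator = 0 from sub_eq_zero.mp (DFunLike.congr_fun this Q)
  refine addMonoidHom_eq_zero (d := p + s) (fun N Q hQ => ?_) fun a l => sub_eq_zero.mpr (h a l)
  refine sub_mem ?_ ?_
  · exact orderLE_mono (by lia) (mul_mem_orderLE hP (mul_mem_orderLE hQ hS))
  · exact orderLE_mono (by lia) (mul_mem_orderLE (mul_mem_orderLE hP hQ) hS)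

section Derivation

variable [IsDerivation D]

theorem del_mul_smul (b : R) (X : MicroDiffOp D) :
    delPow D 1 * b • X = b • (delPow D 1 * X) + D b • X := by
  ext k
  simp only [coeff_del_mul, coeff_add, coeff_smul, IsDerivation.map_mul]
  ring

theorem del_mul_assoc (Q S : MicroDiffOp D) :
    delPow D 1 * (Q * S) = delPow D 1 * Q * S := by
  have del_mul_delPow (l : ℤ) : delPow D 1 * delPow D l = delPow D (l + 1) := by
    ext k
    simp only [coeff_del_mul, coeff_delPow, sub_eq_iff_eq_add]
    split_ifs <;> simp [IsDerivation.map_one]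
  refine mul_assoc_of_forall_smul_delPow (fun a l => ?_) Q
  rw [smul_mul_assoc, del_mul_smul, del_mul_smul, del_mul_delPow_mul, del_mul_delPow, add_mul,
    smul_mul_assoc, smul_mul_assoc]

theorem delPow_mul_assoc (l : ℤ) (Q S : MicroDiffOp D) :
    delPow D l * (Q * S) = delPow D l * Q * S := by
  induction l using Int.induction_on with
  | zero => rw [delPow_zero_mul, delPow_zero_mul]
  | succ l ih => rw [← del_mul_delPow_mul, ih, del_mul_assoc, del_mul_delPow_mul]
  | pred l ih =>
    refine sub_eq_zero.mp (eq_zero_of_del_mul_eq_zero ?_)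
    rw [mul_sub, del_mul_delPow_mul, del_mul_assoc, del_mul_delPow_mul, sub_add_cancel, ih,
      sub_self]

instance : NonUnitalRing (MicroDiffOp D) where
  mul_assoc P Q S := by
    obtain ⟨q, hQ⟩ := Q.exists_mem_orderLE
    obtain ⟨s, hS⟩ := S.exists_mem_orderLE
    let associator : MicroDiffOp D →+ MicroDiffOp D :=
      (AddMonoidHom.mulRight S).comp (AddMonoidHom.mulRight Q) - AddMonoidHom.mulRight (Q * S)
    suffices associator = 0 from sub_eq_zero.mp (DFunLike.congr_fun this P)
    refine addMonoidHom_eq_zero (d := q + s) (fun N P hP => ?_) fun a l => sub_eq_zero.mpr ?_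
    · refine sub_mem ?_ (mul_mem_orderLE hP (mul_mem_orderLE hQ hS))
      exact orderLE_mono (by lia) (mul_mem_orderLE (mul_mem_orderLE hP hQ) hS)
    · simp only [AddMonoidHom.comp_apply, AddMonoidHom.mulRight_apply, smul_mul_assoc,
        delPow_mul_assoc]

end Derivation

theorem mul_smul_of_map_eq_zero [IsDerivation D] {c : R} (hc : D c = 0) (P Q : MicroDiffOp D) :
    P * c • Q = c • (P * Q) := by
  ext k
  rw [coeff_smul, coeff_mul, coeff_mul, mul_finsum' _ _ (finite_support_mulTerm _ _ _)]
  refine finsum_congr fun p => ?_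
  simp only [mulTerm, coeff_smul, IsDerivation.iterate_const_mul hc, mul_smul_comm]
  rw [mul_left_comm]

theorem mapCoeff_add (δ : R →+ R) (P Q : MicroDiffOp D) :
    mapCoeff δ (P + Q) = mapCoeff δ P + mapCoeff δ Q := by
  ext k
  simp only [coeff_mapCoeff, coeff_add, map_add]

theorem mapCoeff_smul {δ : R →+ R} [IsDerivation δ] (c : R) (P : MicroDiffOp D) :
    mapCoeff δ (c • P) = δ c • P + c • mapCoeff δ P := by
  ext k
  simp only [coeff_mapCoeff, coeff_add, coeff_smul, IsDerivation.map_mul]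
  ring

theorem mapCoeff_mul {δ : R →+ R} [IsDerivation δ] (hδ : Function.Commute δ D)
    (P Q : MicroDiffOp D) : mapCoeff δ (P * Q) = mapCoeff δ P * Q + P * mapCoeff δ Q := by
  ext k
  rw [coeff_add, coeff_mapCoeff, coeff_mul, coeff_mul, coeff_mul,
    ← finsum_add_distrib (finite_support_mulTerm _ _ _) (finite_support_mulTerm _ _ _),
    AddMonoidHom.map_finsum δ (finite_support_mulTerm _ _ _)]
  refine finsum_congr fun p => ?_
  simp only [mulTerm, coeff_mapCoeff, map_zsmul, IsDerivation.map_mul,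
    (hδ.iterate_right p.2).eq, smul_add]
  rw [add_comm]

/-! ### Successive approximation -/

theorem exists_limit {M : ℕ → MicroDiffOp D} {p : ℤ}
    (hM : ∀ k : ℕ, M (k + 1) - M k ∈ orderLE D (p - k)) :
    ∃ L : MicroDiffOp D, ∀ k : ℕ, L - M k ∈ orderLE D (p - k) := by
  have stable (k d : ℕ) : M (k + d) - M k ∈ orderLE D (p - k) := by
    induction d with
    | zero => simp
    | succ d ih =>
      have := add_mem (orderLE_mono (by push_cast; lia) (hM (k + d))) ih
      rwa [sub_add_sub_cancel] at this
  obtain ⟨N, hN⟩ := (M 0).exists_mem_orderLE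
  refine ⟨⟨fun j => (M (p - j + 1).toNat).coeff j, max p N, fun j hj => ?_⟩, fun k j hj => ?_⟩
  · rw [show (p - j + 1).toNat = 0 by lia]
    exact hN j (by lia)
  · have h := stable (p - j + 1).toNat (k - (p - j + 1).toNat) j (by lia)
    rw [Nat.add_sub_cancel' (by lia), coeff_sub, sub_eq_zero] at h
    rw [coeff_sub, h]
    exact sub_self _

theorem exists_of_approximation {C : ℤ → MicroDiffOp D → Prop} {p : ℤ} {M₀ : MicroDiffOp D}
    (h₀ : C p M₀) (h_step : ∀ q M, C q M → ∃ M', M' - M ∈ orderLE D q ∧ C (q - 1) M')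
    (h_congr : ∀ q M M', M' - M ∈ orderLE D q → C q M → C q M') :
    ∃ L, L - M₀ ∈ orderLE D p ∧ ∀ k : ℕ, C (p - k) L := by
  choose! next next_sub next_spec using h_step
  let M : ℕ → MicroDiffOp D := Nat.rec M₀ fun k => next (p - k)
  have hM (k : ℕ) : C (p - k) (M k) := by
    induction k with
    | zero => simpa [M] using h₀
    | succ k ih => simpa [sub_sub] using next_spec _ _ ih
  obtain ⟨L, hL⟩ := exists_limit (M := M) fun k => next_sub _ _ (hM k)
  exact ⟨L, by simpa [M] using hL 0, fun k => h_congr _ _ _ (hL k) (hM k)⟩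

/-! ### Monic operators -/

theorem isMonicOfOrder_delPow (l : ℤ) : (delPow D l).IsMonicOfOrder l :=
  ⟨if_pos rfl, delPow_mem_orderLE l⟩

namespace IsMonicOfOrder

variable {X B F : MicroDiffOp D} {m n p q : ℤ}

theorem mem_orderLE (hB : B.IsMonicOfOrder n) : B ∈ orderLE D n := hB.2

theorem mapCoeff_mem_orderLE_sub_one {δ : R →+ R} [IsDerivation δ] (hB : B.IsMonicOfOrder n) :
    mapCoeff δ B ∈ orderLE D (n - 1) :=
  mem_orderLE_sub_one (mapCoeff_mem_orderLE δ hB.mem_orderLE) <| by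
    rw [coeff_mapCoeff, hB.1, IsDerivation.map_one]

theorem of_sub_mem_orderLE (hB : B.IsMonicOfOrder n) (h : X - B ∈ orderLE D (n - 1)) :
    X.IsMonicOfOrder n := by
  refine ⟨?_, fun k hk => ?_⟩
  · rw [← hB.1, ← sub_eq_zero, ← coeff_sub, h n (sub_one_lt n)]
  · rw [← hB.2 k hk, ← sub_eq_zero, ← coeff_sub, h k (by lia)]

theorem sub_mem_orderLE (hX : X.IsMonicOfOrder n) (hB : B.IsMonicOfOrder n) :
    X - B ∈ orderLE D (n - 1) :=
  mem_orderLE_sub_one (sub_mem hX.mem_orderLE hB.mem_orderLE) <| by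
    rw [coeff_sub, hX.1, hB.1, sub_self]

theorem sub_coeff_smul_mem_orderLE (hF : F.IsMonicOfOrder p) (hP : P ∈ orderLE D p) :
    P - P.coeff p • F ∈ orderLE D (p - 1) :=
  mem_orderLE_sub_one (sub_mem hP (Submodule.smul_mem _ _ hF.mem_orderLE)) <| by
    rw [coeff_sub, coeff_smul, hF.1, mul_one, sub_self]

theorem coeff_mul_add (hB : B.IsMonicOfOrder n) (hP : P ∈ orderLE D q) :
    (P * B).coeff (q + n) = P.coeff q := by
  rw [MicroDiffOp.coeff_mul_add hP hB.mem_orderLE, hB.1, mul_one]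

theorem mem_orderLE_of_mul (hB : B.IsMonicOfOrder n) (h : P * B ∈ orderLE D (q + n)) :
    P ∈ orderLE D q :=
  mem_orderLE_of_forall_coeff_eq_zero fun M hM hP => by
    rw [← hB.coeff_mul_add hP, h _ (by lia)]

theorem of_mul (hB : B.IsMonicOfOrder n) (h : (X * B).IsMonicOfOrder (m + n)) :
    X.IsMonicOfOrder m := by
  have hX : X ∈ orderLE D m := hB.mem_orderLE_of_mul h.mem_orderLE
  exact ⟨by rw [← hB.coeff_mul_add hX, h.1], hX⟩

theorem coeff_mul_sub_one [IsDerivation D] (hX : X.IsMonicOfOrder m) (hB : B.IsMonicOfOrder n) :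
    (X * B).coeff (m + n - 1) = X.coeff (m - 1) + B.coeff (n - 1) := by
  rw [coeff_mul_add_sub_one hX.mem_orderLE hB.mem_orderLE, hX.1, hB.1, IsDerivation.map_one]
  ring

theorem mul (hX : X.IsMonicOfOrder m) (hB : B.IsMonicOfOrder n) :
    (X * B).IsMonicOfOrder (m + n) :=
  ⟨by rw [hB.coeff_mul_add hX.mem_orderLE, hX.1], mul_mem_orderLE hX.mem_orderLE hB.mem_orderLE⟩

theorem exists_mul_eq (hB : B.IsMonicOfOrder n) (Q : MicroDiffOp D) : ∃ X, X * B = Q := by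
  obtain ⟨q, hQ⟩ := Q.exists_mem_orderLE
  let C : ℤ → MicroDiffOp D → Prop := fun r X => Q - X * B ∈ orderLE D (r + n)
  have h_step (r : ℤ) (X : MicroDiffOp D) (hX : C r X) :
      ∃ X', X' - X ∈ orderLE D r ∧ C (r - 1) X' := by
    refine ⟨X + (Q - X * B).coeff (r + n) • delPow D r, ?_, ?_⟩
    · rw [add_sub_cancel_left]
      exact Submodule.smul_mem _ _ (delPow_mem_orderLE r)
    · simp only [C]
      rw [add_mul, smul_mul_assoc, ← sub_sub]
      exact orderLE_mono (by lia)
        (((isMonicOfOrder_delPow r).mul hB).sub_coeff_smul_mem_orderLE hX)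
  have h_congr (r : ℤ) (X X' : MicroDiffOp D) (hXX' : X' - X ∈ orderLE D r) (hX : C r X) :
      C r X' := by
    have := sub_mem hX (mul_mem_orderLE hXX' hB.mem_orderLE)
    rwa [sub_mul, sub_sub, add_sub_cancel] at this
  obtain ⟨X, -, hX⟩ := exists_of_approximation (p := q - n) (M₀ := 0) (by simpa [C] using hQ)
    h_step h_congr
  refine ⟨X, (sub_eq_zero.mp <| eq_zero_of_forall_mem_orderLE (N := q) fun k => ?_).symm⟩
  exact orderLE_mono (by lia) (hX k)

end IsMonicOfOrder

/-! ### Covariant derivatives -/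

/-- The covariant derivative `P ↦ ∂P/∂t - [B, P]`, whose kernel consists of the solutions of the
Lax equation `∂P/∂t = [B, P]`. -/
def nabla (δ : R →+ R) (B : MicroDiffOp D) : MicroDiffOp D →+ MicroDiffOp D :=
  AddMonoidHom.mk' (fun P => mapCoeff δ P - commutator B P) fun P Q => by
    simp only [commutator, mapCoeff_add, mul_add, add_mul]
    abel

section Nabla

variable {δ δ' : R →+ R} {B B' : MicroDiffOp D} {m p : ℤ}

theorem nabla_apply (δ : R →+ R) (B P : MicroDiffOp D) :
    nabla δ B P = mapCoeff δ P - (B * P - P * B) := rfl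

theorem nabla_mem_orderLE (hm : 1 ≤ m) (hB : B.IsMonicOfOrder m) (hP : P ∈ orderLE D p) :
    nabla δ B P ∈ orderLE D (p + m - 1) := by
  refine sub_mem (orderLE_mono (by lia) (mapCoeff_mem_orderLE δ hP)) ?_
  have hBP := mul_mem_orderLE hB.mem_orderLE hP
  have coeff_BP := coeff_mul_add hB.mem_orderLE hP
  rw [add_comm m p] at hBP coeff_BP
  refine mem_orderLE_sub_one (sub_mem hBP (mul_mem_orderLE hP hB.mem_orderLE)) ?_
  rw [commutator, coeff_sub, coeff_BP, hB.coeff_mul_add hP, hB.1, one_mul, sub_self]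

variable [IsDerivation D]

theorem coeff_nabla (hm : 2 ≤ m) (hB : B.IsMonicOfOrder m) (hP : P ∈ orderLE D p) :
    (nabla δ B P).coeff (p + m - 1) = -(m * D (P.coeff p)) := by
  have coeff_BP := coeff_mul_add_sub_one hB.mem_orderLE hP
  rw [add_comm m p] at coeff_BP
  rw [nabla_apply, coeff_sub, coeff_sub, coeff_BP, coeff_mul_add_sub_one hP hB.mem_orderLE,
    mapCoeff_mem_orderLE δ hP _ (by lia), hB.1, IsDerivation.map_one]
  ring

theorem map_coeff_eq_zero_of_nabla_mem_orderLE [IsAddTorsionFree R] (hm : 2 ≤ m)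
    (hB : B.IsMonicOfOrder m) (hP : P ∈ orderLE D p) (h : nabla δ B P ∈ orderLE D (p + m - 2)) :
    D (P.coeff p) = 0 := by
  have coeff_eq_zero := h (p + m - 1) (by lia)
  rw [coeff_nabla hm hB hP, neg_eq_zero, ← zsmul_eq_mul] at coeff_eq_zero
  exact (IsAddTorsionFree.zsmul_eq_zero_iff_right (by lia)).mp coeff_eq_zero

variable [IsDerivation δ]

theorem nabla_mul (hδ : Function.Commute δ D) (B P Q : MicroDiffOp D) :
    nabla δ B (P * Q) = nabla δ B P * Q + P * nabla δ B Q := by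
  simp only [nabla_apply, mapCoeff_mul hδ]
  noncomm_ring

theorem nabla_mem_orderLE_of_mul {X Y : MicroDiffOp D} {j n s : ℤ}
    (hδ : Function.Commute δ D) (hX : X ∈ orderLE D j) (hY : Y.IsMonicOfOrder n)
    (h_nabla : nabla δ B Y ∈ orderLE D s) (h_nabla_mul : nabla δ B (X * Y) ∈ orderLE D s) :
    nabla δ B X ∈ orderLE D (max s (j + s) - n) := by
  refine hY.mem_orderLE_of_mul ?_
  rw [eq_sub_of_add_eq (nabla_mul hδ B X Y).symm, sub_add_cancel]
  exact sub_mem (orderLE_mono (le_max_left _ _) h_nabla_mul)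
    (orderLE_mono (le_max_right _ _) (mul_mem_orderLE hX h_nabla))

theorem nabla_smul {c : R} (hc : D c = 0) (B P : MicroDiffOp D) :
    nabla δ B (c • P) = δ c • P + c • nabla δ B P := by
  simp only [nabla_apply, mul_smul_of_map_eq_zero hc, smul_mul_assoc, mapCoeff_smul]
  module

variable [IsDerivation δ'] [IsAddTorsionFree R] {F : ℤ → MicroDiffOp D}

theorem nabla_mem_orderLE_of_nabla_mem_orderLE (hm : 1 ≤ m) (hB : B.IsMonicOfOrder m)
    (hB' : B'.IsMonicOfOrder (m + 1)) (hF : ∀ j, (F j).IsMonicOfOrder j)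
    (h : ∀ j ∈ Finset.Ioo (p - m) p, nabla δ B (F j) ∈ orderLE D (p - 1))
    (h' : ∀ j ∈ Finset.Ioo (p - m) p, nabla δ' B' (F j) ∈ orderLE D p)
    (hP : P ∈ orderLE D (p - 1)) (hP' : nabla δ' B' P ∈ orderLE D p) :
    nabla δ B P ∈ orderLE D (p - 1) := by
  have of_order_lt (d : ℕ) (hd : d < m) (P : MicroDiffOp D) (hP : P ∈ orderLE D (p - m + d))
      (hP' : nabla δ' B' P ∈ orderLE D p) : nabla δ B P ∈ orderLE D (p - 1) := by
    induction d generalizing P with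
    | zero => exact orderLE_mono (by lia) (nabla_mem_orderLE hm hB hP)
    | succ d ih =>
      obtain ⟨j, hj⟩ : ∃ j, j = p - m + (d + 1 : ℕ) := ⟨_, rfl⟩
      rw [← hj] at hP
      have hj_mem : j ∈ Finset.Ioo (p - m) p := Finset.mem_Ioo.mpr ⟨by lia, by lia⟩
      have hF_mem : F j ∈ orderLE D (p - 1) := orderLE_mono (by lia) (hF j).mem_orderLE
      have hc : D (P.coeff j) = 0 := map_coeff_eq_zero_of_nabla_mem_orderLE (by lia) hB' hP
        (orderLE_mono (by lia) hP')
      have h_rest := ih (by lia) (P - P.coeff j • F j)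
        (orderLE_mono (by lia) ((hF j).sub_coeff_smul_mem_orderLE hP)) <| by
          rw [map_sub, nabla_smul hc]
          exact sub_mem hP' (add_mem
            (Submodule.smul_mem _ _ (orderLE_mono (by lia) hF_mem))
            (Submodule.smul_mem _ _ (h' j hj_mem)))
      rw [← sub_add_cancel P (P.coeff j • F j), map_add, nabla_smul hc]
      exact add_mem h_rest
        (add_mem (Submodule.smul_mem _ _ hF_mem) (Submodule.smul_mem _ _ (h j hj_mem)))
  exact of_order_lt (m - 1).toNat (by lia) P (orderLE_mono (by lia) hP) hP'

theorem map_coeff_eq_zero_of_nabla_mem_orderLE_sub_one (hm : 1 ≤ m) (hB : B.IsMonicOfOrder m)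
    (hB' : B'.IsMonicOfOrder (m + 1)) (hF : ∀ j, (F j).IsMonicOfOrder j)
    (h : ∀ j ∈ Finset.Ioc (p - m) p, nabla δ B (F j) ∈ orderLE D (p - 1))
    (h' : ∀ j ∈ Finset.Ioc (p - m) p, nabla δ' B' (F j) ∈ orderLE D (p - 1))
    (hP : P ∈ orderLE D p) (h_nabla : nabla δ B P ∈ orderLE D (p - 1))
    (h_nabla' : nabla δ' B' P ∈ orderLE D (p - 1)) :
    D (P.coeff p) = 0 ∧ δ (P.coeff p) = 0 := by
  set c := P.coeff p
  have hc : D c = 0 := map_coeff_eq_zero_of_nabla_mem_orderLE (by lia) hB' hP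
    (orderLE_mono (by lia) h_nabla')
  have hp_mem : p ∈ Finset.Ioc (p - m) p := Finset.mem_Ioc.mpr ⟨by lia, le_rfl⟩
  have h_rest' : nabla δ' B' (P - c • F p) ∈ orderLE D p := by
    rw [map_sub, nabla_smul hc]
    exact sub_mem (orderLE_mono (by lia) h_nabla') (add_mem
      (Submodule.smul_mem _ _ (hF p).mem_orderLE)
      (Submodule.smul_mem _ _ (orderLE_mono (by lia) (h' p hp_mem))))
  have h_rest : nabla δ B (P - c • F p) ∈ orderLE D (p - 1) :=
    nabla_mem_orderLE_of_nabla_mem_orderLE hm hB hB' hF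
      (fun j hj => h j (Finset.Ioo_subset_Ioc_self hj))
      (fun j hj => orderLE_mono (by lia) (h' j (Finset.Ioo_subset_Ioc_self hj)))
      ((hF p).sub_coeff_smul_mem_orderLE hP) h_rest'
  have h_leading : δ c • F p ∈ orderLE D (p - 1) := by
    have := sub_mem (sub_mem h_nabla h_rest) (Submodule.smul_mem _ c (h p hp_mem))
    rwa [map_sub, sub_sub_cancel, nabla_smul hc, add_sub_cancel_right] at this
  refine ⟨hc, ?_⟩
  simpa [(hF p).1] using h_leading p (sub_one_lt p)

end Nabla

theorem laxEquations_iff_nabla_eq_zero {δ : ℕ+ → R →+ R} {B : ℕ+ → MicroDiffOp D}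
    {L : MicroDiffOp D} : LaxEquations δ B L ↔ ∀ m, nabla (δ m) (B m) L = 0 :=
  forall_congr' fun _ => sub_eq_zero.symm

end MicroDiffOp

/-! ### Asymptotically constant sequences -/

section AsymptoticallyConstant

variable {R κ : Type*} [AddCommGroup R]

/-- Each of the operators `D` and `δ m` eventually annihilates the sequence `c`; the bound may
depend on `m`. -/
def AsymptoticallyConstant (D : R →+ R) (δ : κ → R →+ R) (c : ℕ → R) : Prop :=
  (∀ᶠ n in atTop, D (c n) = 0) ∧ ∀ m, ∀ᶠ n in atTop, δ m (c n) = 0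

/-- A sequence whose successive differences are asymptotically constant has a limit, in the sense
that it differs from a single element by an asymptotically constant sequence. For formal power
series in infinitely many times this plays the role of completeness. -/
def IsCompleteModConstants (D : R →+ R) (δ : κ → R →+ R) : Prop :=
  ∀ a : ℕ → R, AsymptoticallyConstant D δ (fun n => a n - a (n + 1)) →
    ∃ f, AsymptoticallyConstant D δ fun n => f - a n

/-- A sequence with asymptotically constant differences eventually stays in a coset of `ker D`,
where only the derivations `δ m` remain. -/
theorem IsCompleteModConstants.of_exact {S : Type*} [AddCommGroup S] {D : R →+ R}
    {δ : κ → R →+ R} {δ' : κ → S →+ S} {ι : S →+ R} (h : IsCompleteModConstants 0 δ')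
    (hι : Function.Injective ι) (hD : Function.Exact ι D)
    (hδ : ∀ m c, δ m (ι c) = ι (δ' m c)) : IsCompleteModConstants D δ := by
  rintro a ⟨haD, haδ⟩
  obtain ⟨n₀, hn₀⟩ := eventually_atTop.mp haD
  have exists_eq (n : ℕ) (hn : n₀ ≤ n) : ∃ c, ι c = a n - a n₀ := by
    refine (hD _).mp ?_
    induction n, hn using Nat.le_induction with
    | base => rw [sub_self, map_zero]
    | succ n hn ih =>
      rw [← sub_sub_sub_cancel_left (a n₀) (a (n + 1)) (a n), map_sub, ih, hn₀ n hn, sub_zero]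
  choose! g hg using exists_eq
  obtain ⟨f, -, hf⟩ := h g ⟨.of_forall fun _ => rfl, fun m => by
    filter_upwards [haδ m, eventually_ge_atTop n₀] with n h_sub hn
    refine hι ?_
    rw [← hδ, map_sub, hg n hn, hg (n + 1) (by lia), sub_sub_sub_cancel_right, h_sub, map_zero]⟩
  have limit_sub (n : ℕ) (hn : n₀ ≤ n) : a n₀ + ι f - a n = ι (f - g n) := by
    rw [map_sub, hg n hn]
    abel
  refine ⟨a n₀ + ι f, ?_, fun m => ?_⟩
  · filter_upwards [eventually_ge_atTop n₀] with n hn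
    rw [limit_sub n hn, hD.apply_apply_eq_zero]
  · filter_upwards [hf m, eventually_ge_atTop n₀] with n h_zero hn
    rw [limit_sub n hn, hδ, h_zero, map_zero]

end AsymptoticallyConstant

namespace MicroDiffOp

/-! ### Horizontal approximations -/

variable {R : Type*} [CommRing R] {D : R →+ R}

/-- The covariant derivatives `∂/∂t_m - [B_m, ·]` of the sequence `N` have orders tending to
`-∞`, for each `m`. -/
def AsymptoticallyHorizontal (δ : ℕ+ → R →+ R) (B : ℕ+ → MicroDiffOp D)
    (N : ℕ → MicroDiffOp D) : Prop :=
  ∀ (m : ℕ+) (s : ℤ), ∀ᶠ n in atTop, nabla (δ m) (B m) (N n) ∈ orderLE D s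

/-- Asymptotically horizontal sequences `F j`, one for each order `j`, of monic operators. -/
structure IsHorizontalFrame (δ : ℕ+ → R →+ R) (B : ℕ+ → MicroDiffOp D)
    (F : ℤ → ℕ → MicroDiffOp D) : Prop where
  isMonicOfOrder (j : ℤ) (n : ℕ) : (F j n).IsMonicOfOrder j
  asymptoticallyHorizontal (j : ℤ) : AsymptoticallyHorizontal δ B (F j)

/-- Modulo operators of order at most `p`, the operator `M` is eventually equal to an
asymptotically horizontal sequence. -/
def IsHorizontalModOrder (δ : ℕ+ → R →+ R) (B : ℕ+ → MicroDiffOp D) (p : ℤ)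
    (M : MicroDiffOp D) : Prop :=
  ∃ N, AsymptoticallyHorizontal δ B N ∧ ∀ᶠ n in atTop, M - N n ∈ orderLE D p

section

variable {δ : ℕ+ → R →+ R} {B : ℕ+ → MicroDiffOp D} {N N' : ℕ → MicroDiffOp D} {p : ℤ}

namespace AsymptoticallyHorizontal

theorem add (hN : AsymptoticallyHorizontal δ B N) (hN' : AsymptoticallyHorizontal δ B N') :
    AsymptoticallyHorizontal δ B fun n => N n + N' n := fun m s => by
  filter_upwards [hN m s, hN' m s] with n h h'
  rw [map_add]
  exact add_mem h h'

theorem sub_succ (hN : AsymptoticallyHorizontal δ B N) :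
    AsymptoticallyHorizontal δ B fun n => N n - N (n + 1) := fun m s => by
  filter_upwards [hN m s, (tendsto_add_atTop_nat 1).eventually (hN m s)] with n h h'
  rw [map_sub]
  exact sub_mem h h'

variable [IsDerivation D] [∀ m, IsDerivation (δ m)]

theorem smul {c : ℕ → R} (hc : AsymptoticallyConstant D δ c)
    (hN : AsymptoticallyHorizontal δ B N) :
    AsymptoticallyHorizontal δ B fun n => c n • N n := fun m s => by
  filter_upwards [hN m s, hc.1, hc.2 m] with n h hD hδ
  rw [nabla_smul hD, hδ, zero_smul, zero_add]
  exact Submodule.smul_mem _ _ h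

theorem asymptoticallyConstant_coeff [IsAddTorsionFree R] {F : ℤ → ℕ → MicroDiffOp D}
    (hF : IsHorizontalFrame δ B F) (hB : ∀ n : ℕ+, (B n).IsMonicOfOrder (n : ℤ))
    (hN : AsymptoticallyHorizontal δ B N) (h_order : ∀ᶠ n in atTop, N n ∈ orderLE D p) :
    AsymptoticallyConstant D δ fun n => (N n).coeff p := by
  have eventually_map_eq_zero (m : ℕ+) :
      ∀ᶠ n in atTop, D ((N n).coeff p) = 0 ∧ δ m ((N n).coeff p) = 0 := by
    have frame (m' : ℕ+) := (Finset.Ioc (p - m) p).eventually_all.mpr fun j _ =>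
      hF.asymptoticallyHorizontal j m' (p - 1)
    filter_upwards [h_order, hN m (p - 1), hN (m + 1) (p - 1), frame m, frame (m + 1)]
      with n h_order h_nabla h_nabla' h_frame h_frame'
    exact map_coeff_eq_zero_of_nabla_mem_orderLE_sub_one (by exact_mod_cast (one_le : 1 ≤ m))
      (hB m) (by exact_mod_cast hB (m + 1)) (hF.isMonicOfOrder · n) h_frame h_frame' h_order
      h_nabla h_nabla'
  exact ⟨(eventually_map_eq_zero 1).mono fun _ => And.left,
    fun m => (eventually_map_eq_zero m).mono fun _ => And.right⟩

end AsymptoticallyHorizontal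

theorem nabla_mem_orderLE_of_zakharovShabat [∀ m, IsDerivation (δ m)]
    (hB : ∀ n : ℕ+, (B n).IsMonicOfOrder (n : ℤ)) (hZS : ZakharovShabat δ B) (m n : ℕ+) :
    nabla (δ m) (B m) (B n) ∈ orderLE D (m - 1) := by
  have nabla_eq : nabla (δ m) (B m) (B n) = mapCoeff (δ n) (B m) := by
    rw [← sub_eq_zero, ← hZS n m, nabla_apply, commutator]
    abel
  rw [nabla_eq]
  exact (hB m).mapCoeff_mem_orderLE_sub_one

theorem IsHorizontalModOrder.nabla_mem_orderLE {M : MicroDiffOp D}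
    (hB : ∀ n : ℕ+, (B n).IsMonicOfOrder (n : ℤ)) (hM : IsHorizontalModOrder δ B p M) (m : ℕ+) :
    nabla (δ m) (B m) M ∈ orderLE D (p + m - 1) := by
  obtain ⟨N, hN, hMN⟩ := hM
  obtain ⟨n, h_nabla, h_sub⟩ := ((hN m (p + m - 1)).and hMN).exists
  rw [← sub_add_cancel M (N n), map_add]
  refine add_mem (MicroDiffOp.nabla_mem_orderLE ?_ (hB m) h_sub) h_nabla
  exact_mod_cast (one_le : 1 ≤ m)

variable [IsDerivation D] [∀ m, IsDerivation (δ m)]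

/-- The quotients `B_{n + j} B_n⁻¹` form a frame: they have order `j`, whereas the covariant
derivative `∂B_m/∂t_n` of `B_n` along `t_m` has order less than `m`, whatever `n`. -/
theorem exists_isHorizontalFrame (hδ : ∀ m, Function.Commute (δ m) D)
    (hB : ∀ n : ℕ+, (B n).IsMonicOfOrder (n : ℤ)) (hZS : ZakharovShabat δ B) :
    ∃ F, IsHorizontalFrame δ B F ∧ ((∀ n : ℕ+, (B n).coeff ((n : ℤ) - 1) = 0) →
      ∀ j n, (F j n).coeff (j - 1) = 0) := by
  let den (j : ℤ) (n : ℕ) : ℕ+ := (n + j.natAbs).succPNat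
  let num (j : ℤ) (n : ℕ) : ℕ+ := (n + j.natAbs + j).toNat.succPNat
  have num_eq (j : ℤ) (n : ℕ) : (num j n : ℤ) = j + den j n := by
    simp only [num, den, Nat.succPNat_coe]; lia
  choose F hF using fun j n => (hB (den j n)).exists_mul_eq (B (num j n))
  have monic (j : ℤ) (n : ℕ) : (F j n).IsMonicOfOrder j :=
    (hB (den j n)).of_mul (by rw [hF, ← num_eq]; exact hB _)
  refine ⟨F, ⟨monic, fun j m s => ?_⟩, fun h_sub j n => ?_⟩
  · have nabla_B := nabla_mem_orderLE_of_zakharovShabat hB hZS m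
    filter_upwards [eventually_ge_atTop (max ((m : ℤ) - 1) (j + (m - 1)) - s).toNat] with n hn
    have h := nabla_mem_orderLE_of_mul (hδ m) (monic j n).mem_orderLE (hB (den j n)) (nabla_B _)
      (by rw [hF]; exact nabla_B _)
    refine orderLE_mono ?_ h
    simp only [den, Nat.succPNat_coe]
    lia
  · have h := (monic j n).coeff_mul_sub_one (hB (den j n))
    rwa [hF, ← num_eq, h_sub, h_sub, add_zero, eq_comm] at h

theorem IsHorizontalModOrder.exists_improvement [IsAddTorsionFree R]
    (h_complete : IsCompleteModConstants D δ) {F : ℤ → ℕ → MicroDiffOp D}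
    (hF : IsHorizontalFrame δ B F) (hB : ∀ n : ℕ+, (B n).IsMonicOfOrder (n : ℤ))
    {M : MicroDiffOp D} (hM : IsHorizontalModOrder δ B p M) :
    ∃ M', M' - M ∈ orderLE D p ∧ IsHorizontalModOrder δ B (p - 1) M' := by
  obtain ⟨N, hN, hMN⟩ := hM
  have sub_succ_mem : ∀ᶠ n in atTop, N n - N (n + 1) ∈ orderLE D p := by
    filter_upwards [hMN, (tendsto_add_atTop_nat 1).eventually hMN] with n h h'
    simpa using sub_mem h' h
  obtain ⟨f, hf⟩ := h_complete (fun n => (N n).coeff p)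
    (hN.sub_succ.asymptoticallyConstant_coeff hF hB sub_succ_mem)
  refine ⟨M + (f - M.coeff p) • delPow D p, ?_, fun n => N n + (f - (N n).coeff p) • F p n,
    hN.add ((hF.asymptoticallyHorizontal p).smul hf), hMN.mono fun n hn => ?_⟩
  · rw [add_sub_cancel_left]
    exact Submodule.smul_mem _ _ (delPow_mem_orderLE p)
  · have hFn := hF.isMonicOfOrder p n
    refine mem_orderLE_sub_one ?_ ?_
    · rw [add_sub_add_comm]
      exact add_mem hn (sub_mem (Submodule.smul_mem _ _ (delPow_mem_orderLE p))
        (Submodule.smul_mem _ _ hFn.mem_orderLE))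
    · simp [hFn.1, (isMonicOfOrder_delPow p).1]

theorem IsHorizontalModOrder.exists_laxEquations [IsAddTorsionFree R]
    (h_complete : IsCompleteModConstants D δ) {F : ℤ → ℕ → MicroDiffOp D}
    (hF : IsHorizontalFrame δ B F) (hB : ∀ n : ℕ+, (B n).IsMonicOfOrder (n : ℤ))
    {M : MicroDiffOp D} (hM : IsHorizontalModOrder δ B p M) :
    ∃ L, L - M ∈ orderLE D p ∧ LaxEquations δ B L := by
  obtain ⟨L, hLM, hL⟩ := exists_of_approximation (C := IsHorizontalModOrder δ B) hM
    (fun q M hM => hM.exists_improvement h_complete hF hB)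
    fun q M M' hMM' ⟨N, hN, hMN⟩ => ⟨N, hN, hMN.mono fun n hn => by
      simpa using add_mem hMM' hn⟩
  refine ⟨L, hLM, laxEquations_iff_nabla_eq_zero.mpr fun m => ?_⟩
  refine eq_zero_of_forall_mem_orderLE (N := p + m - 1) fun k => ?_
  exact orderLE_mono (by lia) ((hL k).nabla_mem_orderLE hB m)

theorem exists_laxEquations_of_zakharovShabat [IsAddTorsionFree R]
    (h_complete : IsCompleteModConstants D δ) (hδ : ∀ m, Function.Commute (δ m) D)
    (hB : ∀ n : ℕ+, (B n).IsMonicOfOrder (n : ℤ)) (hZS : ZakharovShabat δ B) :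
    ∃ L : MicroDiffOp D, L.IsMonicOfOrder 1 ∧ LaxEquations δ B L ∧
      ((∀ n : ℕ+, (B n).coeff ((n : ℤ) - 1) = 0) → L.coeff 0 = 0) := by
  obtain ⟨F, hF, hF_sub⟩ := exists_isHorizontalFrame hδ hB hZS
  have exists_lax {p : ℤ} (hp : p ≤ 0) (h : ∀ n, delPow D 1 - F 1 n ∈ orderLE D p) :
      ∃ L, L.IsMonicOfOrder 1 ∧ LaxEquations δ B L ∧ L - delPow D 1 ∈ orderLE D p := by
    have h_approx : IsHorizontalModOrder δ B p (delPow D 1) :=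
      ⟨F 1, hF.asymptoticallyHorizontal 1, .of_forall h⟩
    obtain ⟨L, hL, h_lax⟩ := h_approx.exists_laxEquations h_complete hF hB
    exact ⟨L, (isMonicOfOrder_delPow 1).of_sub_mem_orderLE (orderLE_mono hp hL), h_lax, hL⟩
  have del_sub_frame (n : ℕ) : delPow D 1 - F 1 n ∈ orderLE D 0 :=
    (isMonicOfOrder_delPow 1).sub_mem_orderLE (hF.isMonicOfOrder 1 n)
  by_cases h_sub : ∀ n : ℕ+, (B n).coeff ((n : ℤ) - 1) = 0
  · obtain ⟨L, h_monic, h_lax, hL⟩ := exists_lax (by norm_num : (0 - 1 : ℤ) ≤ 0) fun n =>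
      mem_orderLE_sub_one (del_sub_frame n) <| by
        simpa [coeff_delPow] using hF_sub h_sub 1 n
    exact ⟨L, h_monic, h_lax, fun _ => by simpa [coeff_delPow] using hL 0 (by norm_num)⟩
  · obtain ⟨L, h_monic, h_lax, -⟩ := exists_lax le_rfl del_sub_frame
    exact ⟨L, h_monic, h_lax, fun h => absurd h h_sub⟩

end
end MicroDiffOp

/-! ### Formal power series in the times -/

section MvPowerSeries

variable {σ A : Type*} [CommRing A]

instance [IsAddTorsionFree A] : IsAddTorsionFree (MvPowerSeries σ A) :=
  inferInstanceAs (IsAddTorsionFree ((σ →₀ ℕ) → A))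

theorem mvPowerSeries_pderiv_eq_zero_iff [IsAddTorsionFree A] {i : σ} {f : MvPowerSeries σ A} :
    MvPowerSeries.pderiv A i f = 0 ↔ ∀ α : σ →₀ ℕ, α i ≠ 0 → MvPowerSeries.coeff α f = 0 := by
  refine ⟨fun h α hα => ?_, fun h => MvPowerSeries.ext fun α => ?_⟩
  · have single_le : Finsupp.single i 1 ≤ α :=
      Finsupp.single_le_iff.mpr (Nat.one_le_iff_ne_zero.mpr hα)
    have coeff_eq := congrArg (MvPowerSeries.coeff (α - Finsupp.single i 1)) h
    rw [MvPowerSeries.coeff_pderiv, tsub_add_cancel_of_le single_le, map_zero, ← Nat.cast_succ,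
      ← nsmul_eq_mul'] at coeff_eq
    exact (nsmul_eq_zero_iff_right (Nat.succ_ne_zero _)).mp coeff_eq
  · rw [MvPowerSeries.coeff_pderiv, h _ (by simp), zero_mul, map_zero]

theorem isCompleteModConstants_pderiv [IsAddTorsionFree A] :
    IsCompleteModConstants (0 : MvPowerSeries σ A →+ MvPowerSeries σ A)
      fun i => (MvPowerSeries.pderiv A i).toLinearMap.toAddMonoidHom := by
  rintro a ⟨-, ha⟩
  have coeff_eq (i : σ) : ∃ n₀, ∀ n ≥ n₀, ∀ α : σ →₀ ℕ, α i ≠ 0 →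
      MvPowerSeries.coeff α (a n) = MvPowerSeries.coeff α (a n₀) := by
    obtain ⟨n₀, h⟩ := eventually_atTop.mp (ha i)
    refine ⟨n₀, fun n hn α hα => ?_⟩
    induction n, hn using Nat.le_induction with
    | base => rfl
    | succ n hn ih =>
      rw [← ih, eq_comm, ← sub_eq_zero, ← map_sub]
      exact mvPowerSeries_pderiv_eq_zero_iff.mp (h n hn) α hα
  have exists_eventual_value (α : σ →₀ ℕ) (hα : α ≠ 0) :
      ∃ x, ∀ᶠ n in atTop, MvPowerSeries.coeff α (a n) = x := by
    obtain ⟨i, hi⟩ := Finsupp.ne_iff.mp hα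
    obtain ⟨n₀, h⟩ := coeff_eq i
    exact ⟨_, eventually_atTop.mpr ⟨n₀, fun n hn => h n hn α hi⟩⟩
  obtain ⟨f, hf⟩ : ∃ f : MvPowerSeries σ A, ∀ α ≠ 0,
      ∀ᶠ n in atTop, MvPowerSeries.coeff α (a n) = MvPowerSeries.coeff α f := by
    choose! x hx using exists_eventual_value
    exact ⟨x, hx⟩
  refine ⟨f, .of_forall fun _ => rfl, fun i => ?_⟩
  obtain ⟨n₀, h⟩ := coeff_eq i
  filter_upwards [eventually_ge_atTop n₀] with n hn
  refine mvPowerSeries_pderiv_eq_zero_iff.mpr fun α hα => ?_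
  have hα' : α ≠ 0 := by rintro rfl; exact hα rfl
  obtain ⟨N, hN, h_ge⟩ := ((hf α hα').and (eventually_ge_atTop n₀)).exists
  rw [map_sub, ← hN, h N h_ge α hα, h n hn α hα, sub_self]

end MvPowerSeries

/-! ### Power series in `x` -/

section PowerSeries

variable (A : Type*) [CommRing A]

theorem coeff_powerSeriesDx (f : PowerSeries (TimeSeries A)) (k : ℕ) :
    PowerSeries.coeff k (powerSeriesDx A f) = (k + 1) • PowerSeries.coeff (k + 1) f := by
  rw [nsmul_eq_mul', Nat.cast_succ]
  exact PowerSeries.coeff_derivative f k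

theorem coeff_powerSeriesDt (n : ℕ+) (f : PowerSeries (TimeSeries A)) (k : ℕ) :
    PowerSeries.coeff k (powerSeriesDt A n f) = MvPowerSeries.pderiv A n (PowerSeries.coeff k f) :=
  PowerSeries.coeff_mk k fun k => MvPowerSeries.pderiv A n (PowerSeries.coeff k f)

instance : IsDerivation (powerSeriesDx A) where
  map_mul f g := by
    rw [mul_comm (powerSeriesDx A f)]
    exact (PowerSeries.derivative (TimeSeries A)).leibniz f g

instance (n : ℕ+) : IsDerivation (powerSeriesDt A n) where
  map_mul f g := by
    ext1 k
    simp only [map_add, coeff_powerSeriesDt, PowerSeries.coeff_mul, map_sum, Derivation.leibniz,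
      smul_eq_mul, Finset.sum_add_distrib, mul_comm (PowerSeries.coeff _ g)]

theorem commute_powerSeriesDt_powerSeriesDx (n : ℕ+) :
    Function.Commute (powerSeriesDt A n) (powerSeriesDx A) := fun f => by
  ext1 k
  rw [coeff_powerSeriesDt, coeff_powerSeriesDx, coeff_powerSeriesDx, coeff_powerSeriesDt,
    map_nsmul]

theorem isCompleteModConstants_powerSeries [IsAddTorsionFree A] :
    IsCompleteModConstants (powerSeriesDx A) (powerSeriesDt A) := by
  refine isCompleteModConstants_pderiv.of_exact
    (ι := (PowerSeries.C (R := TimeSeries A)).toAddMonoidHom)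
    PowerSeries.C_injective (fun f => ⟨fun hf => ⟨PowerSeries.constantCoeff f, ?_⟩, ?_⟩)
    fun m c => ?_
  · refine PowerSeries.derivative.ext (PowerSeries.derivative_C.trans hf.symm) ?_
    exact PowerSeries.constantCoeff_C _
  · rintro ⟨c, rfl⟩
    exact PowerSeries.derivative_C
  · ext1 k
    rw [coeff_powerSeriesDt]
    simp only [RingHom.toAddMonoidHom_eq_coe, AddMonoidHom.coe_coe, PowerSeries.coeff_C]
    split_ifs <;> simp

end PowerSeries

/-! ### Laurent series in `x` -/

section LaurentSeries

instance {Γ M : Type*} [PartialOrder Γ] [AddMonoid M] [IsAddTorsionFree M] :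
    IsAddTorsionFree (HahnSeries Γ M) :=
  HahnSeries.coeff_injective.isAddTorsionFree
    { toFun := HahnSeries.coeff, map_zero' := rfl, map_add' := fun _ _ => rfl }

theorem isDerivation_of_coeff_eq {Γ S : Type*} [AddCommMonoid Γ] [PartialOrder Γ]
    [IsOrderedCancelAddMonoid Γ] [CommRing S] {T : HahnSeries Γ S →+ HahnSeries Γ S}
    (φ : Γ → S →+ S) (hT : ∀ f k, (T f).coeff k = φ k (f.coeff k))
    (hφ : ∀ i j a b, φ (i + j) (a * b) = a * φ j b + φ i a * b) : IsDerivation T where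
  map_mul f g := by
    have support_subset (f : HahnSeries Γ S) : (T f).support ⊆ f.support := fun k hk hfk =>
      hk (by rw [hT, hfk, map_zero])
    ext k
    rw [hT, HahnSeries.coeff_add, HahnSeries.coeff_mul,
      HahnSeries.coeff_mul_right' g.isPWO_support (support_subset g),
      HahnSeries.coeff_mul_left' f.isPWO_support (support_subset f), map_sum,
      ← Finset.sum_add_distrib]
    refine Finset.sum_congr rfl fun ij hij => ?_
    rw [← (Finset.mem_antidiagonal.mp hij).2.2, hφ, hT, hT]

variable (A : Type*) [CommRing A]

theorem coeff_laurentSeriesDx (f : LaurentSeries (TimeSeries A)) (k : ℤ) :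
    (laurentSeriesDx A f).coeff k = (k + 1) • f.coeff (k + 1) := by
  refine (LaurentSeries.hasseDeriv_coeff (R := TimeSeries A) 1 f k).trans ?_
  rw [Nat.cast_one, Ring.choose_one_right]

theorem coeff_laurentSeriesDt (n : ℕ+) (f : LaurentSeries (TimeSeries A)) (k : ℤ) :
    (laurentSeriesDt A n f).coeff k = MvPowerSeries.pderiv A n (f.coeff k) := rfl

/-- The Euler operator `x ∂` preserves degrees, so its Leibniz rule can be checked on coefficients;
then cancel `x`. -/
instance : IsDerivation (laurentSeriesDx A) where
  map_mul f g := by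
    let x : LaurentSeries (TimeSeries A) := HahnSeries.single 1 1
    have euler : IsDerivation ((AddMonoidHom.mulLeft x).comp (laurentSeriesDx A)) :=
      isDerivation_of_coeff_eq (fun k => zsmulAddGroupHom k)
        (fun f k => by simp [x, HahnSeries.coeff_single_mul, coeff_laurentSeriesDx])
        fun i j a b => by
          simp only [zsmulAddGroupHom_apply, zsmul_eq_mul, Int.cast_add]
          ring
    have hx : IsUnit x := .of_mul_eq_one (HahnSeries.single (-1) 1) (by simp [x])
    refine hx.mul_left_cancel ?_
    have := euler.map_mul f g
    simp only [AddMonoidHom.comp_apply, AddMonoidHom.coe_mulLeft] at this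
    rw [this]
    ring

instance (n : ℕ+) : IsDerivation (laurentSeriesDt A n) :=
  isDerivation_of_coeff_eq (fun _ => (MvPowerSeries.pderiv A n).toLinearMap.toAddMonoidHom)
    (fun _ _ => rfl) fun _ _ a b => by
      refine ((MvPowerSeries.pderiv A n).leibniz a b).trans ?_
      rw [smul_eq_mul, smul_eq_mul, mul_comm b]
      rfl

theorem commute_laurentSeriesDt_laurentSeriesDx (n : ℕ+) :
    Function.Commute (laurentSeriesDt A n) (laurentSeriesDx A) := fun f => by
  ext k
  rw [coeff_laurentSeriesDt, coeff_laurentSeriesDx, coeff_laurentSeriesDx, coeff_laurentSeriesDt,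
    map_zsmul]

theorem isCompleteModConstants_laurentSeries [IsAddTorsionFree A] :
    IsCompleteModConstants (laurentSeriesDx A) (laurentSeriesDt A) := by
  refine isCompleteModConstants_pderiv.of_exact
    (ι := (HahnSeries.C (Γ := ℤ) (R := TimeSeries A)).toAddMonoidHom)
    HahnSeries.C_injective (fun f => ⟨fun hf => ⟨f.coeff 0, ?_⟩, ?_⟩) fun m c => ?_
  · ext k
    rcases eq_or_ne k 0 with rfl | hk
    · simp
    · have coeff_eq := congrArg (HahnSeries.coeff · (k - 1)) hf
      simp only [coeff_laurentSeriesDx, sub_add_cancel, HahnSeries.coeff_zero] at coeff_eq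
      simp [hk, (IsAddTorsionFree.zsmul_eq_zero_iff_right hk).mp coeff_eq]
  · rintro ⟨c, rfl⟩
    ext k
    by_cases hk : k + 1 = 0 <;> simp [coeff_laurentSeriesDx, hk]
  · ext k
    by_cases hk : k = 0 <;> simp [coeff_laurentSeriesDt, hk]

end LaurentSeries

theorem isAddTorsionFree_of_algebra_complex (A : Type*) [CommRing A] [Algebra ℂ A] :
    IsAddTorsionFree A :=
  letI := Module.compHom A (algebraMap ℚ ℂ)
  .of_module_rat A

end

theorem mainTheorem2_general (A : Type*) [CommRing A] [IsAddTorsionFree A] :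
    (∀ B : ℕ+ → MicroDiffOp (powerSeriesDx A),
      (∀ n, (B n).IsMonicOfOrder (n : ℤ)) →
      MicroDiffOp.ZakharovShabat (powerSeriesDt A) B →
      ∃ L : MicroDiffOp (powerSeriesDx A),
        L.IsMonicOfOrder 1 ∧
        MicroDiffOp.LaxEquations (powerSeriesDt A) B L ∧
        ((∀ n : ℕ+, (B n).coeff ((n : ℤ) - 1) = 0) → L.coeff 0 = 0)) ∧
    (∀ B : ℕ+ → MicroDiffOp (laurentSeriesDx A),
      (∀ n, (B n).IsMonicOfOrder (n : ℤ)) →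
      MicroDiffOp.ZakharovShabat (laurentSeriesDt A) B →
      ∃ L : MicroDiffOp (laurentSeriesDx A),
        L.IsMonicOfOrder 1 ∧
        MicroDiffOp.LaxEquations (laurentSeriesDt A) B L ∧
        ((∀ n : ℕ+, (B n).coeff ((n : ℤ) - 1) = 0) → L.coeff 0 = 0)) :=
  ⟨fun _ => MicroDiffOp.exists_laxEquations_of_zakharovShabat
      (isCompleteModConstants_powerSeries A) (commute_powerSeriesDt_powerSeriesDx A),
    fun _ => MicroDiffOp.exists_laxEquations_of_zakharovShabat
      (isCompleteModConstants_laurentSeries A) (commute_laurentSeriesDt_laurentSeriesDx A)⟩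

theorem mainTheorem2 (A : Type*) [CommRing A] [Algebra ℂ A] :
    (∀ B : ℕ+ → MicroDiffOp (powerSeriesDx A),
      (∀ n, (B n).IsDifferential ∧ (B n).IsMonicOfOrder (n : ℤ)) →
      MicroDiffOp.ZakharovShabat (powerSeriesDt A) B →
      ∃ L : MicroDiffOp (powerSeriesDx A),
        L.IsMonicOfOrder 1 ∧
        MicroDiffOp.LaxEquations (powerSeriesDt A) B L ∧
        ((∀ n : ℕ+, (B n).coeff ((n : ℤ) - 1) = 0) → L.coeff 0 = 0)) ∧
    (∀ B : ℕ+ → MicroDiffOp (laurentSeriesDx A),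
      (∀ n, (B n).IsDifferential ∧ (B n).IsMonicOfOrder (n : ℤ)) →
      MicroDiffOp.ZakharovShabat (laurentSeriesDt A) B →
      ∃ L : MicroDiffOp (laurentSeriesDx A),
        L.IsMonicOfOrder 1 ∧
        MicroDiffOp.LaxEquations (laurentSeriesDt A) B L ∧
        ((∀ n : ℕ+, (B n).coeff ((n : ℤ) - 1) = 0) → L.coeff 0 = 0)) := by
  have := isAddTorsionFree_of_algebra_complex A
  have h := mainTheorem2_general A
  exact ⟨fun B hB => h.1 B fun n => (hB n).2, fun B hB => h.2 B fun n => (hB n).2⟩
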